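/- All graphs are finite and simple. A connected dominating set of a graph $G$ is a set $D\subseteq V(G)$ such that every vertex of $G$ is in $D$ or adjacent to a vertex of $D$, and the induced subgraph $G[D]$ is connected (and nonempty). The connected domination number $\gamma_c(G)$ is the minimum cardinality of a connected dominating set of $G$, with $\gamma_c(G)=\infty$ if $G$ has none (that is, if $G$ is not connected). A graph $G$ is maximal $3$-$\gamma_c$-vertex critical if $\gamma_c(G)=3$, $\gamma_c(G+uv)<3$ for every pair of distinct non-adjacent vertices $u,v$ of $G$, and $\gamma_c(G-v)<3$ for every vertex $v$ of $G$. (In particular, such a graph is $2$-connected.) The connectivity $\kappa(G)$ is the minimum cardinality of a set $S\subseteq V(G)$ such that $G-S$ is disconnected (and $|V(G)|-1$ if $G$ is complete), and $\delta(G)$ is the minimum degree of $G$. Corollary. Let $G$ be a maximal $3$-$\gamma_c$-vertex critical graph. If $\kappa(G)<\delta(G)$, then $G$ is hamiltonian connected: every two distinct vertices $u,v$ of $G$ are joined by a hamiltonian path, i.e. a path with ends $u$ and $v$ that contains all vertices of $G$. -/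

import Mathlib

/-- `D` is a connected dominating set of `G`: every vertex lies in `D` or has a neighbour in `D`,
and the subgraph `G[D]` induced by `D` is connected (in particular `D` is nonempty). -/
def SimpleGraph.IsConnectedDominatingSet {V : Type*} (G : SimpleGraph V) (D : Set V) : Prop :=
  (∀ v, v ∈ D ∨ ∃ d ∈ D, G.Adj d v) ∧ (G.induce D).Connected

/-- The connected domination number `γ_c(G)`: the least cardinality of a connected dominating set.
It is `⊤` when `G` has no connected dominating set, i.e. when `G` is not connected. -/
noncomputable def SimpleGraph.connectedDominationNumber {V : Type*} (G : SimpleGraph V) : ℕ∞ :=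
  sInf (Set.encard '' {D : Set V | G.IsConnectedDominatingSet D})

/-- `G` is `k`-`γ_c`-edge critical: `γ_c(G) = k`, and `γ_c(G + uv) < k` for each pair of
non-adjacent vertices `u ≠ v`. -/
def SimpleGraph.IsConnectedDominationEdgeCritical {V : Type*} (G : SimpleGraph V) (k : ℕ) : Prop :=
  G.connectedDominationNumber = k ∧
    ∀ u v : V, u ≠ v → ¬ G.Adj u v →
      (G ⊔ SimpleGraph.edge u v).connectedDominationNumber < k

/-- `G` is `k`-`γ_c`-vertex critical: `γ_c(G) = k`, and `γ_c(G - v) < k` for each vertex `v`.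
Since `γ_c` of a disconnected graph is `⊤`, such a graph is connected and has no cut vertex. -/
def SimpleGraph.IsConnectedDominationVertexCritical {V : Type*} (G : SimpleGraph V) (k : ℕ) :
    Prop :=
  G.connectedDominationNumber = k ∧
    ∀ v : V, (G.induce ({v}ᶜ : Set V)).connectedDominationNumber < k

/-- `G` is a maximal `k`-`γ_c`-vertex critical graph: it is both `k`-`γ_c`-edge critical and
`k`-`γ_c`-vertex critical. -/
def SimpleGraph.IsMaximalConnectedDominationVertexCritical {V : Type*} (G : SimpleGraph V)
    (k : ℕ) : Prop :=
  G.IsConnectedDominationEdgeCritical k ∧ G.IsConnectedDominationVertexCritical k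

/-- `S` is a (vertex) cut set of `G`: some two vertices outside `S` are not joined by a path in
`G - S`. -/
def SimpleGraph.IsVertexCut {V : Type*} (G : SimpleGraph V) (S : Set V) : Prop :=
  ¬ (G.induce Sᶜ).Preconnected

open Classical in
/-- The (vertex) connectivity `κ(G)` of a finite graph: the least cardinality of a cut set. A graph
without cut sets, i.e. a complete graph, has connectivity `|V| - 1` by the usual convention. -/
noncomputable def SimpleGraph.vertexConnectivity {V : Type*} (G : SimpleGraph V) : ℕ :=
  if ∃ S, G.IsVertexCut S then sInf (Set.ncard '' {S : Set V | G.IsVertexCut S})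
  else Nat.card V - 1

/-- `G` is hamiltonian connected: any two distinct vertices are joined by a hamiltonian path. -/
def SimpleGraph.IsHamiltonianConnected {V : Type*} [DecidableEq V] (G : SimpleGraph V) : Prop :=
  ∀ u v : V, u ≠ v → ∃ p : G.Walk u v, p.IsHamiltonian

/-! The theorem follows from a Chvátal–Erdős condition: a connected graph whose independent sets are
all smaller than its vertex cuts is hamiltonian connected
(`isHamiltonianConnected_of_indepSet_card_lt`, by a longest-path argument). What remains is the
bound `α < κ` (`indepSet_card_lt`).

Criticality becomes a statement about edges that dominate all vertices but one: every vertex is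
missed by such an edge, and for non-adjacent `u`, `v` either the pair `u`, `v` dominates or an edge
at one of them misses exactly the other. Let `S` be a minimum cut. Since `κ < δ`, each side of `S`
has two vertices or more, so every edge missing just one vertex has an end in `S`.

Let `I` be independent with `|I| = |S|`. If `|I \ S| ≤ 1`, a few such edges give a contradiction.
Otherwise any two vertices of `I \ S` are joined to `S` by an edge at one that misses the other, and
its end in `S \ I` has a unique non-neighbour in `I`. Counting these ends ("spokes") leaves a single
unexplained vertex `s₀` of `S \ I`. This rigid structure forces a vertex of degree at most `|S| =
κ`, against `κ < δ`. -/

namespace SimpleGraph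

section

variable {V : Type*} {G : SimpleGraph V}

/-! ### Criticality in terms of edges missing one vertex -/

/-- The edge `ab` dominates every vertex of `G` except `v`. -/
def DominatesExcept (G : SimpleGraph V) (a b v : V) : Prop :=
  G.Adj a b ∧ a ≠ v ∧ b ≠ v ∧ ¬ G.Adj a v ∧ ¬ G.Adj b v ∧
    ∀ x, x ≠ v → x = a ∨ x = b ∨ G.Adj a x ∨ G.Adj b x

theorem DominatesExcept.symm {a b v : V} (h : G.DominatesExcept a b v) :
    G.DominatesExcept b a v := by
  obtain ⟨h1, h2, h3, h4, h5, h6⟩ := h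
  refine ⟨h1.symm, h3, h2, h5, h4, fun x hx => ?_⟩
  have := h6 x hx
  tauto

theorem connectedDominationNumber_le_two {a b : V} (hab : G.Adj a b)
    (h : ∀ x, x = a ∨ x = b ∨ G.Adj a x ∨ G.Adj b x) : G.connectedDominationNumber ≤ 2 := by
  have hD : G.IsConnectedDominatingSet {a, b} := by
    refine ⟨fun x => ?_, induce_pair_connected_of_adj hab⟩
    rcases h x with h | h | h | h
    · simp [h]
    · simp [h]
    · exact Or.inr ⟨a, by simp, h⟩
    · exact Or.inr ⟨b, by simp, h⟩
  exact (sInf_le (Set.mem_image_of_mem Set.encard hD)).trans (Set.encard_pair hab.ne).le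

theorem exists_of_connectedDominationNumber_lt_three (h : G.connectedDominationNumber < 3) :
    ∃ a b, (a = b ∨ G.Adj a b) ∧ ∀ x, x = a ∨ x = b ∨ G.Adj a x ∨ G.Adj b x := by
  obtain ⟨_, ⟨D, ⟨hdom, hconn⟩, rfl⟩, hD⟩ := sInf_lt_iff.1 h
  obtain ⟨⟨a, ha⟩⟩ := hconn.nonempty
  by_cases hs : D ⊆ {a}
  · refine ⟨a, a, Or.inl rfl, fun x => ?_⟩
    rcases hdom x with hx | ⟨d, hd, hx⟩
    · exact Or.inl (hs hx)
    · have : d = a := hs hd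
      subst this; tauto
  · obtain ⟨c, hc, hca⟩ := Set.not_subset.1 hs
    have : Nontrivial D := ⟨⟨a, ha⟩, ⟨c, hc⟩, fun h => hca (by simpa using h.symm)⟩
    obtain ⟨⟨b, hb⟩, hab⟩ := hconn.preconnected.exists_adj_of_nontrivial ⟨a, ha⟩
    have hab : G.Adj a b := hab
    have hsub : ∀ d ∈ D, d = a ∨ d = b := by
      intro d hd
      by_contra hne
      push Not at hne
      have h3 : ({a, b, d} : Set V).encard = 3 := by
        rw [Set.encard_insert_of_notMem, Set.encard_pair hne.2.symm]
        · rfl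
        · simp only [Set.mem_insert_iff, Set.mem_singleton_iff, not_or]
          exact ⟨hab.ne, hne.1.symm⟩
      have : ({a, b, d} : Set V).encard ≤ D.encard := by
        apply Set.encard_le_encard
        rintro x (rfl | rfl | rfl) <;> assumption
      rw [h3] at this
      exact absurd hD (not_lt.2 this)
    refine ⟨a, b, Or.inr hab, fun x => ?_⟩
    rcases hdom x with hx | ⟨d, hd, hx⟩
    · have := hsub x hx; tauto
    · rcases hsub d hd with rfl | rfl <;> tauto

/-- A dominating edge of `G - v` must miss `v`, as no edge dominates `G`. A single dominating vertex
of `G - v` cannot occur: with a neighbour of `v` it would give an edge dominating `G`. -/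
theorem IsConnectedDominationVertexCritical.exists_dominatesExcept
    (hG : G.IsConnectedDominationVertexCritical 3) (hdeg : ∀ v, ∃ w, G.Adj v w) (v : V) :
    ∃ a b, G.DominatesExcept a b v := by
  have hno : ∀ a b, G.Adj a b → ¬ ∀ x, x = a ∨ x = b ∨ G.Adj a x ∨ G.Adj b x := by
    intro a b hab h
    have := connectedDominationNumber_le_two hab h
    rw [hG.1] at this
    exact absurd this (by decide)
  obtain ⟨⟨a, ha⟩, ⟨b, hb⟩, hab, hdom⟩ := exists_of_connectedDominationNumber_lt_three (hG.2 v)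
  simp only [Subtype.mk.injEq, comap_adj, Function.Embedding.subtype_apply, Subtype.forall,
    Set.mem_compl_iff, Set.mem_singleton_iff] at hab hdom ha hb
  rcases hab with rfl | hab
  · obtain ⟨w, hw⟩ := hdeg v
    exfalso
    by_cases hwa : w = a
    · subst hwa
      refine hno w v hw.symm fun x => ?_
      by_cases hx : x = v
      · tauto
      · have := hdom x hx; tauto
    · have h1 := hdom w hw.ne'
      refine hno a w (by tauto) fun x => ?_
      by_cases hx : x = v
      · subst hx; have := hw.symm; tauto
      · have := hdom x hx; tauto
  · have key : ¬ (G.Adj a v ∨ G.Adj b v) := by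
      intro h
      refine hno a b hab fun x => ?_
      by_cases hx : x = v
      · subst hx; tauto
      · exact hdom x hx
    exact ⟨a, b, hab, ha, hb, by tauto, by tauto, hdom⟩

/-- A dominating pair of `G + uv` that is an edge of `G` needs the new edge, so it contains exactly
one of `u`, `v` and misses exactly the other. The only other adjacent pair is `u`, `v` itself. -/
theorem IsConnectedDominationEdgeCritical.dominates_or_exists_dominatesExcept
    (hG : G.IsConnectedDominationEdgeCritical 3) (hdeg : ∀ v, ∃ w, G.Adj v w) {u v : V}
    (huv : u ≠ v) (hadj : ¬ G.Adj u v) :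
    (∀ x, x = u ∨ x = v ∨ G.Adj u x ∨ G.Adj v x) ∨
      (∃ y, G.DominatesExcept u y v) ∨ ∃ y, G.DominatesExcept v y u := by
  have hno : ∀ a b, G.Adj a b → ∃ x, x ≠ a ∧ x ≠ b ∧ ¬ G.Adj a x ∧ ¬ G.Adj b x := by
    intro a b hab
    by_contra! h
    have := connectedDominationNumber_le_two hab (fun x => by have := h x; tauto)
    rw [hG.1] at this
    exact absurd this (by decide)
  obtain ⟨a, b, hab, hdom⟩ := exists_of_connectedDominationNumber_lt_three (hG.2 u v huv hadj)
  simp only [sup_adj, edge_adj] at hab hdom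
  have hs : ∀ x y, G.Adj x y → G.Adj y x := fun _ _ h => h.symm
  -- A vertex missing only `w` would form a dominating edge with any neighbour of `w`.
  have hone : ∀ a w, ¬ G.Adj a w → a ≠ w → (∀ x, x ≠ w → x = a ∨ G.Adj a x) → False := by
    intro a w haw hne h
    obtain ⟨z, hz⟩ := hdeg w
    obtain ⟨x, hx⟩ := hno a z (by have := h z hz.ne'; have := hz.symm; grind only)
    have := hs w z hz
    have := h x
    grind only
  unfold DominatesExcept
  rcases hab with rfl | hab
  · exfalso
    obtain ⟨z, hz⟩ := hdeg a
    obtain ⟨x, hx⟩ := hno a z hz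
    by_cases hau : a = u
    · subst hau
      exact hone a v hadj huv (by clear hno hdeg hone; grind only)
    · by_cases hav : a = v
      · subst hav
        exact hone a u (fun h => hadj h.symm) huv.symm (by clear hno hdeg hone; grind only)
      · clear hno hdeg hone; grind only
  · have hi := fun x => G.irrefl (v := x)
    rcases hab with hab | hab
    · obtain ⟨x, hx⟩ := hno a b hab
      clear hno hdeg hone
      by_cases hau : a = u
      · subst hau
        refine Or.inr (Or.inl ⟨b, ?_⟩)
        grind only
      by_cases hav : a = v
      · subst hav
        refine Or.inr (Or.inr ⟨b, ?_⟩)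
        grind only
      by_cases hbu : b = u
      · subst hbu
        refine Or.inr (Or.inl ⟨a, ?_⟩)
        grind only
      by_cases hbv : b = v
      · subst hbv
        refine Or.inr (Or.inr ⟨a, ?_⟩)
        grind only
      grind only
    · left
      clear hno hdeg hone
      grind only

/-! ### Minimum vertex cuts -/

theorem isVertexCut_of_closed {T : Set V} {P : V → Prop} {a b : V} (ha : a ∉ T) (hb : b ∉ T)
    (hPa : P a) (hPb : ¬ P b) (h : ∀ x y, x ∉ T → y ∉ T → G.Adj x y → P x → P y) :
    G.IsVertexCut T := by
  intro hc
  obtain ⟨p⟩ := hc ⟨a, ha⟩ ⟨b, hb⟩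
  have key : ∀ x y : (Tᶜ : Set V), (G.induce Tᶜ).Walk x y → P x → P y := by
    intro x y p
    induction p with
    | nil => exact id
    | @cons x y _ hadj _ ih => exact fun hx => ih (h x y x.2 y.2 hadj hx)
  exact hPb (key _ _ p hPa)

theorem IsVertexCut.vertexConnectivity_le {T : Set V} (hT : G.IsVertexCut T) :
    G.vertexConnectivity ≤ T.ncard := by
  rw [vertexConnectivity, if_pos ⟨T, hT⟩]
  exact Nat.sInf_le ⟨T, hT, rfl⟩

theorem exists_isVertexCut_ncard_eq [Fintype V] [DecidableRel G.Adj]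
    (h : G.vertexConnectivity < G.minDegree) :
    ∃ S, G.IsVertexCut S ∧ S.ncard = G.vertexConnectivity := by
  by_cases hex : ∃ S, G.IsVertexCut S
  · rw [vertexConnectivity, if_pos hex]
    obtain ⟨S, hS, hc⟩ := Nat.sInf_mem (s := Set.ncard '' {S : Set V | G.IsVertexCut S})
      (Set.Nonempty.image _ hex)
    exact ⟨S, hS, hc⟩
  · exfalso
    rw [vertexConnectivity, if_neg hex, Nat.card_eq_fintype_card] at h
    rcases isEmpty_or_nonempty V with hV | ⟨⟨v⟩⟩
    · simp at h
    · have h1 := G.minDegree_le_degree v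
      have h2 := G.degree_lt_card_verts v
      omega

/-- A minimum vertex cut of a graph whose connectivity is less than its minimum degree splits the
remaining vertices into two sides, each of which has at least two vertices and meets the
neighbourhood of each vertex of the cut. -/
theorem exists_separation [Fintype V] [DecidableEq V] [DecidableRel G.Adj]
    (h : G.vertexConnectivity < G.minDegree) :
    ∃ (S : Finset V) (c : V → Bool), S.card = G.vertexConnectivity ∧
      (∀ x y, x ∉ S → y ∉ S → G.Adj x y → c x = c y) ∧
      (∀ t v, ∃ x, x ∉ S ∧ c x = t ∧ x ≠ v) ∧
      ∀ t, ∀ s ∈ S, ∃ x, x ∉ S ∧ c x = t ∧ G.Adj s x := by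
  classical
  obtain ⟨S, hS, hcard⟩ := exists_isVertexCut_ncard_eq h
  have hS' := hS
  simp only [IsVertexCut, Preconnected, not_forall] at hS'
  obtain ⟨a, b, hab⟩ := hS'
  set c : V → Bool := fun x => decide (∃ h : x ∈ Sᶜ, (G.induce Sᶜ).Reachable a ⟨x, h⟩) with hc
  have hadj : ∀ x y, x ∉ S → y ∉ S → G.Adj x y → c x = c y := by
    intro x y hx hy hxy
    have hxy' : (G.induce Sᶜ).Adj ⟨x, hx⟩ ⟨y, hy⟩ := hxy
    simp only [hc, decide_eq_decide]
    exact ⟨fun ⟨_, h⟩ => ⟨hy, h.trans hxy'.reachable⟩,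
      fun ⟨_, h⟩ => ⟨hx, h.trans hxy'.symm.reachable⟩⟩
  have hside : ∀ t, ∃ x, x ∉ S ∧ c x = t := by
    intro t
    cases t
    · refine ⟨b, b.2, ?_⟩
      simp only [hc, decide_eq_false_iff_not]
      exact fun ⟨_, h⟩ => hab h
    · refine ⟨a, a.2, ?_⟩
      simp only [hc, decide_eq_true_eq]
      exact ⟨a.2, Reachable.refl _⟩
  refine ⟨S.toFinset, c, by rw [← hcard, Set.ncard_eq_toFinset_card'], ?_, ?_, ?_⟩
  · simpa using hadj
  · intro t v
    obtain ⟨x, hx, hxt⟩ := hside t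
    by_cases hxv : x = v
    -- The degree of `x` exceeds `|S|`, so `x` has a neighbour outside `S`, necessarily on its own
    -- side.
    · have hdeg : ¬ G.neighborFinset x ⊆ S.toFinset := by
        intro hsub
        have h1 := Finset.card_le_card hsub
        rw [card_neighborFinset_eq_degree, ← Set.ncard_eq_toFinset_card', hcard] at h1
        have := G.minDegree_le_degree x
        omega
      obtain ⟨y, hy, hyS⟩ := Finset.not_subset.1 hdeg
      rw [mem_neighborFinset] at hy
      rw [Set.mem_toFinset] at hyS
      exact ⟨y, by simpa using hyS, by rw [← hadj x y hx hyS hy, hxt], by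
        rw [← hxv]; exact hy.ne'⟩
    · exact ⟨x, by simpa using hx, hxt, hxv⟩
  · intro t s hs
    rw [Set.mem_toFinset] at hs
    by_contra! hno
    obtain ⟨x, hx, hxt⟩ := hside t
    -- If `s` had no neighbour on side `t`, the smaller set `S \ {s}` would still separate that side
    -- from `s`.
    have hcut : G.IsVertexCut (S \ {s}) := by
      refine isVertexCut_of_closed (P := fun z => z ∉ S ∧ c z = t) (a := x) (b := s)
        (by simp [hx]) (by simp) ⟨hx, hxt⟩ (by simp [hs]) ?_
      rintro z w - hw hzw ⟨hz, hzt⟩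
      by_cases hws : w = s
      · subst hws
        exact absurd hzw.symm (hno z (by simpa using hz) hzt)
      · have hw : w ∉ S := fun h => hw ⟨h, hws⟩
        exact ⟨hw, by rw [← hadj z w hz hw hzw, hzt]⟩
    have h1 := hcut.vertexConnectivity_le
    have h2 := Set.ncard_sdiff_singleton_lt_of_mem hs S.toFinite
    omega

/-! ### Independent sets equal or nearly equal to the cut -/

/-- The domination properties of a maximal `3`-`γ_c`-vertex critical graph together with a vertex
set `S` whose removal leaves two sides `c ⁻¹' {t}` without edges between them. -/
structure IsCriticalSeparation (G : SimpleGraph V) (S : Finset V) (c : V → Bool) : Prop where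
  dominates_or : ∀ u v, u ≠ v → ¬ G.Adj u v → (∀ x, x = u ∨ x = v ∨ G.Adj u x ∨ G.Adj v x) ∨
    (∃ y, G.DominatesExcept u y v) ∨ ∃ y, G.DominatesExcept v y u
  exists_dominatesExcept : ∀ v, ∃ a b, G.DominatesExcept a b v
  side_eq : ∀ x y, x ∉ S → y ∉ S → G.Adj x y → c x = c y
  exists_side_ne : ∀ t v, ∃ x, x ∉ S ∧ c x = t ∧ x ≠ v
  exists_side_adj : ∀ t, ∀ s ∈ S, ∃ x, x ∉ S ∧ c x = t ∧ G.Adj s x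

namespace IsCriticalSeparation

variable {S : Finset V} {c : V → Bool}

/-- An edge avoiding `S` lies within one side, and the other side contains a vertex besides `v` that
it fails to dominate. -/
theorem mem_or_mem (h : G.IsCriticalSeparation S c) {a b v : V} (hd : G.DominatesExcept a b v) :
    a ∈ S ∨ b ∈ S := by
  by_contra! hab
  obtain ⟨h1, -, -, -, -, h6⟩ := hd
  obtain ⟨x, hx, hxc, hxv⟩ := h.exists_side_ne (!c a) v
  have hs := h.side_eq a b hab.1 hab.2 h1
  have hne : c x ≠ c a := by rw [hxc]; simp
  rcases h6 x hxv with rfl | rfl | h7 | h7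
  · exact hne rfl
  · exact hne hs.symm
  · exact hne (h.side_eq a x hab.1 hx h7).symm
  · exact hne (hs.trans (h.side_eq b x hab.2 hx h7)).symm

theorem exists_mem_dominatesExcept (h : G.IsCriticalSeparation S c) (v : V) :
    ∃ s ∈ S, ∃ b, G.DominatesExcept s b v := by
  obtain ⟨a, b, hab⟩ := h.exists_dominatesExcept v
  rcases h.mem_or_mem hab with hs | hs
  · exact ⟨a, hs, b, hab⟩
  · exact ⟨b, hs, a, hab.symm⟩

theorem exists_dominatesExcept_or (h : G.IsCriticalSeparation S c) {u v w : V} (hu : u ∉ S)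
    (hv : v ∉ S) (huv : u ≠ v) (hadj : ¬ G.Adj u v) (hwu : w ≠ u) (hwv : w ≠ v)
    (huw : ¬ G.Adj u w) (hvw : ¬ G.Adj v w) :
    (∃ y ∈ S, G.DominatesExcept u y v) ∨ ∃ y ∈ S, G.DominatesExcept v y u := by
  rcases h.dominates_or u v huv hadj with hd | ⟨y, hd⟩ | ⟨y, hd⟩
  · have := hd w; tauto
  · exact Or.inl ⟨y, (h.mem_or_mem hd).resolve_left hu, hd⟩
  · exact Or.inr ⟨y, (h.mem_or_mem hd).resolve_left hv, hd⟩

theorem not_adj_of_side_ne (h : G.IsCriticalSeparation S c) {x y : V} (hx : x ∉ S) (hy : y ∉ S)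
    (hxy : c x ≠ c y) : ¬ G.Adj x y := fun hadj => hxy (h.side_eq x y hx hy hadj)

/-- If `S ⊆ {s, t}`, an edge `s b` missing `t` has `b ∉ S`. A neighbour `x` of `t` on the side
opposite to `b` is then adjacent to `s` too, so no edge meeting `S` misses `x`. -/
theorem three_le_card [DecidableEq V] [Nonempty V] (h : G.IsCriticalSeparation S c) :
    3 ≤ S.card := by
  by_contra! hlt
  obtain ⟨t, ht, -⟩ := h.exists_mem_dominatesExcept (Classical.arbitrary V)
  obtain ⟨s, hs, b, hsb, hst, hbt, -, -, hdom⟩ := h.exists_mem_dominatesExcept t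
  have hS : ∀ z ∈ S, z = s ∨ z = t := by
    intro z hz
    by_contra! hne
    have h3 : ({s, t, z} : Finset V).card = 3 :=
      Finset.card_eq_three.2 ⟨s, t, z, hst, hne.1.symm, hne.2.symm, rfl⟩
    have := Finset.card_le_card (s := {s, t, z}) (t := S) (by
      simp [Finset.insert_subset_iff, hs, ht, hz])
    omega
  have hb : b ∉ S := fun hb => (hS b hb).elim hsb.ne' hbt
  obtain ⟨x, hx, hxc, htx⟩ := h.exists_side_adj (!c b) t ht
  have hcx : c b ≠ c x := by rw [hxc]; simp
  have hsx : G.Adj s x := by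
    rcases hdom x (by rintro rfl; exact hx ht) with rfl | rfl | h1 | h1
    · exact absurd hs hx
    · exact absurd rfl hcx
    · exact h1
    · exact absurd h1 (h.not_adj_of_side_ne hb hx hcx)
  obtain ⟨z, hz, d, -, -, -, hzx, -⟩ := h.exists_mem_dominatesExcept x
  rcases hS z hz with rfl | rfl
  · exact hzx hsx
  · exact hzx htx

/-- In an edge `s b` missing some `x ∉ S`, the end `b` must do all the dominating inside the
independent set `S`. Then no edge meeting `S` can miss `b`. -/
theorem false_of_forall_not_adj [Nonempty V] (h : G.IsCriticalSeparation S c)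
    (hS : ∀ x ∈ S, ∀ y ∈ S, ¬ G.Adj x y) : False := by
  obtain ⟨x, hx, -⟩ := h.exists_side_ne true (Classical.arbitrary V)
  obtain ⟨s, hs, b, hsb, -, -, -, -, hdom⟩ := h.exists_mem_dominatesExcept x
  have hb : ∀ z ∈ S, G.Adj b z := by
    intro z hz
    rcases hdom z (by rintro rfl; exact hx hz) with rfl | rfl | h1 | h1
    · exact hsb.symm
    · exact absurd hsb (hS s hs z hz)
    · exact absurd h1 (hS s hs z hz)
    · exact h1
  obtain ⟨z, hz, d, -, -, -, hzb, -⟩ := h.exists_mem_dominatesExcept b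
  exact hzb (hb z hz).symm

theorem false_of_sdiff_eq_singleton [DecidableEq V] (h : G.IsCriticalSeparation S c)
    {I : Finset V} {u s₀ : V} (hI : ∀ x ∈ I, ∀ y ∈ I, ¬ G.Adj x y) (hu : I \ S = {u})
    (hs₀ : S \ I = {s₀}) : False := by
  have hu' : u ∈ I \ S := by rw [hu]; exact Finset.mem_singleton_self u
  obtain ⟨huI, huS⟩ := Finset.mem_sdiff.1 hu'
  have hs₀' : s₀ ∈ S \ I := by rw [hs₀]; exact Finset.mem_singleton_self s₀
  obtain ⟨hs₀S, -⟩ := Finset.mem_sdiff.1 hs₀'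
  have hS : ∀ z ∈ S, z ∈ I ∨ z = s₀ := by
    intro z hz
    by_contra! hne
    exact hne.2 (Finset.mem_singleton.1 (hs₀ ▸ Finset.mem_sdiff.2 ⟨hz, hne.1⟩))
  obtain ⟨x, hx, hxc, hs₀x⟩ := h.exists_side_adj (!c u) s₀ hs₀S
  have hcx : c u ≠ c x := by rw [hxc]; simp
  have hux := h.not_adj_of_side_ne huS hx hcx
  have hune : u ≠ x := fun e => hcx (by rw [e])
  -- `x` is adjacent to `s₀`, so the end `j` in `S` lies in `I`. Hence `b` lies outside `I ∪ S` and
  -- is adjacent to all of `I`.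
  obtain ⟨j, hjS, b, hjb, hjx, hbx, hjx', hbx', hdom⟩ := h.exists_mem_dominatesExcept x
  have hjI : j ∈ I := (hS j hjS).resolve_right (by rintro rfl; exact hjx' hs₀x)
  have hbI : b ∉ I := fun hb => hI j hjI b hb hjb
  have hbS : b ∉ S := fun hb => (hS b hb).elim hbI (by rintro rfl; exact hbx' hs₀x)
  have hbadj : ∀ z ∈ I, z ≠ x → G.Adj b z := by
    intro z hz hzx
    rcases hdom z hzx with rfl | rfl | h1 | h1
    · exact hjb.symm
    · exact absurd hz hbI
    · exact absurd h1 (hI j hjI z hz)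
    · exact h1
  have hbu : G.Adj b u := hbadj u huI hune
  have hcb : c b = c u := h.side_eq b u hbS huS hbu
  have hbs₀ : ¬ G.Adj s₀ b := by
    intro hadj
    obtain ⟨z, hz, d, -, -, -, hzb, -⟩ := h.exists_mem_dominatesExcept b
    rcases hS z hz with hzI | rfl
    · exact hzb (hbadj z hzI (by rintro rfl; exact hx hz)).symm
    · exact hzb hadj
  -- Neither `u` nor `x` dominates `j`. An edge `u y` missing `x` has no possible `y`; an edge `x y`
  -- missing `u` leaves `j` undominated if `y ∈ I`, and `b` if `y = s₀`.
  rcases h.exists_dominatesExcept_or huS hx hune hux (w := j) (by rintro rfl; exact huS hjS) hjx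
    (hI u huI j hjI) (fun hadj => hjx' hadj.symm) with ⟨y, hy, huy, -, -, -, hyx, -⟩ |
    ⟨y, hy, hxy, -, -, -, hyu, hdom'⟩
  · rcases hS y hy with hyI | rfl
    · exact hI u huI y hyI huy
    · exact hyx hs₀x
  · rcases hS y hy with hyI | rfl
    · rcases hdom' j (by rintro rfl; exact huS hjS) with rfl | rfl | h1 | h1
      · exact hx hjS
      · exact hjx' hxy.symm
      · exact hjx' h1.symm
      · exact hI y hyI j hjI h1
    · rcases hdom' b hbu.ne with rfl | rfl | h1 | h1
      · exact hcx hcb.symm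
      · exact hbS hy
      · exact h.not_adj_of_side_ne hx hbS (by rw [hcb]; exact hcx.symm) h1
      · exact hbs₀ h1

end IsCriticalSeparation

/-! ### Spoke systems -/

/-- `y v` is adjacent to all vertices of the independent set `I` but `v`, for all vertices `v` of
`I` outside `S` but one such vertex `u₀`, and the vertices `y v` exhaust `S \ I` up to one vertex
`s₀`. -/
structure IsSpokeSystem (G : SimpleGraph V) (S I : Finset V) (u₀ s₀ : V) (y : V → V) : Prop where
  not_adj : ∀ x ∈ I, ∀ y ∈ I, ¬ G.Adj x y
  mem : u₀ ∈ I
  notMem : u₀ ∉ S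
  exists_ne : ∃ v ∈ I, v ∉ S ∧ v ≠ u₀
  arrow : ∀ u ∈ I, u ∉ S → ∀ v ∈ I, v ∉ S → u ≠ v →
    (∃ z ∈ S, G.DominatesExcept u z v) ∨ ∃ z ∈ S, G.DominatesExcept v z u
  spoke_mem : ∀ v ∈ I, v ∉ S → v ≠ u₀ → y v ∈ S
  spoke_not_adj : ∀ v ∈ I, v ∉ S → v ≠ u₀ → ¬ G.Adj (y v) v
  spoke_adj : ∀ v ∈ I, v ∉ S → v ≠ u₀ → ∀ w ∈ I, w ≠ v → G.Adj (y v) w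
  spoke_or : ∀ v ∈ I, v ∉ S → v ≠ u₀ → G.DominatesExcept u₀ (y v) v ∨
    ∃ u ∈ I, ∃ z ∈ S, G.DominatesExcept u z u₀
  mem_extra : s₀ ∈ S
  notMem_extra : s₀ ∉ I
  spoke_ne : ∀ v ∈ I, v ∉ S → v ≠ u₀ → y v ≠ s₀
  eq_or : ∀ s ∈ S, s ∈ I ∨ s = s₀ ∨ ∃ v ∈ I, v ∉ S ∧ v ≠ u₀ ∧ s = y v

/-- Since `u` has no neighbour in `I`, the end `z` alone accounts for `I`; thus `v` is determined by
`z`. -/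
theorem DominatesExcept.adj_of_not_adj {u z v : V} {I : Finset V}
    (hI : ∀ x ∈ I, ∀ y ∈ I, ¬ G.Adj x y) (h : G.DominatesExcept u z v) (hu : u ∈ I) :
    z ∉ I ∧ ¬ G.Adj z v ∧ ∀ w ∈ I, w ≠ v → G.Adj z w := by
  obtain ⟨h1, -, -, -, h5, h6⟩ := h
  have hz : z ∉ I := fun hz => hI u hu z hz h1
  refine ⟨hz, h5, fun w hw hwv => ?_⟩
  rcases h6 w hwv with rfl | rfl | h7 | h7
  · exact h1.symm
  · exact absurd hw hz
  · exact absurd h7 (hI u hu w hw)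
  · exact h7

namespace IsSpokeSystem

variable {S I : Finset V} {u₀ s₀ : V} {y : V → V} {c : V → Bool}

theorem eq_spoke (hy : G.IsSpokeSystem S I u₀ s₀ y) {z v : V} (hz : z ∈ S) (hzI : z ∉ I)
    (hz₀ : z ≠ s₀) (hv : v ∈ I) (hvz : ¬ G.Adj z v) : z = y v := by
  obtain h | h | ⟨w, hw, hwS, hw₀, rfl⟩ := hy.eq_or z hz
  · exact absurd h hzI
  · exact absurd h hz₀
  · by_cases hvw : v = w
    · rw [hvw]
    · exact absurd (hy.spoke_adj w hw hwS hw₀ v hv hvw) hvz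

theorem eq_extra (hy : G.IsSpokeSystem S I u₀ s₀ y) {z : V} (hz : z ∈ S) (hzI : z ∉ I)
    (hzu : ¬ G.Adj z u₀) : z = s₀ := by
  obtain h | h | ⟨w, hw, hwS, hw₀, rfl⟩ := hy.eq_or z hz
  · exact absurd h hzI
  · exact h
  · exact absurd (hy.spoke_adj w hw hwS hw₀ u₀ hy.mem hw₀.symm) hzu

/-- If `s₀` is not adjacent to `u₀` then `S \ I` is a clique. -/
theorem adj_of_mem (hy : G.IsSpokeSystem S I u₀ s₀ y) (hs₀ : ¬ G.Adj s₀ u₀) {a b : V} (ha : a ∈ S)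
    (haI : a ∉ I) (hb : b ∈ S) (hbI : b ∉ I) (hab : a ≠ b) : G.Adj a b := by
  -- Here `z` is adjacent to `u₀`, hence is not `s₀`, hence is `y w`. As `y v` is not adjacent to
  -- `v`, the edge can reach it only through `y w`.
  have key : ∀ v w, v ∈ I → v ∉ S → v ≠ u₀ → w ∈ I → w ∉ S → w ≠ u₀ → y v ≠ y w → ∀ z ∈ S,
      G.DominatesExcept v z w → G.Adj (y v) (y w) := by
    intro v w hv hvS hv₀ hw hwS hw₀ hne z hz hd
    obtain ⟨h1, h2, h3⟩ := hd.adj_of_not_adj hy.not_adj hv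
    have hzw : z = y w := hy.eq_spoke hz h1
      (by rintro rfl; exact hs₀ (h3 u₀ hy.mem hw₀.symm)) hw h2
    subst hzw
    obtain ⟨-, -, -, -, -, hdom⟩ := hd
    have hyS := hy.spoke_mem v hv hvS hv₀
    rcases hdom (y v) (by rintro h; exact hwS (h ▸ hyS)) with h | h | h | h
    · exact absurd (h ▸ hyS) hvS
    · exact absurd h hne
    · exact absurd h.symm (hy.spoke_not_adj v hv hvS hv₀)
    · exact h.symm
  have key' : ∀ v, v ∈ I → v ∉ S → v ≠ u₀ → G.Adj s₀ (y v) := by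
    intro v hv hvS hv₀
    rcases hy.arrow u₀ hy.mem hy.notMem v hv hvS hv₀.symm with ⟨z, hz, hd⟩ | ⟨z, hz, hd⟩
    · obtain ⟨h1, h2, h3⟩ := hd.adj_of_not_adj hy.not_adj hy.mem
      have hzv : z = y v := hy.eq_spoke hz h1
        (by rintro rfl; exact hs₀ (h3 u₀ hy.mem hv₀.symm)) hv h2
      subst hzv
      obtain ⟨-, -, -, -, -, hdom⟩ := hd
      rcases hdom s₀ (by rintro rfl; exact hvS hy.mem_extra) with h | h | h | h
      · exact absurd (h ▸ hy.mem_extra) hy.notMem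
      · exact absurd h.symm (hy.spoke_ne v hv hvS hv₀)
      · exact absurd h.symm hs₀
      · exact h.symm
    · obtain ⟨h1, h2, h3⟩ := hd.adj_of_not_adj hy.not_adj hv
      have hzv := hy.eq_extra hz h1 h2
      subst hzv
      obtain ⟨-, -, -, -, -, hdom⟩ := hd
      have hyS := hy.spoke_mem v hv hvS hv₀
      rcases hdom (y v) (by intro h; exact hy.notMem (h ▸ hyS)) with h | h | h | h
      · exact absurd (h ▸ hyS) hvS
      · exact absurd h (hy.spoke_ne v hv hvS hv₀)
      · exact absurd h.symm (hy.spoke_not_adj v hv hvS hv₀)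
      · exact h
  obtain h | rfl | ⟨v, hv, hvS, hv₀, rfl⟩ := hy.eq_or a ha
  · exact absurd h haI
  · obtain h | rfl | ⟨w, hw, hwS, hw₀, rfl⟩ := hy.eq_or b hb
    · exact absurd h hbI
    · exact absurd rfl hab
    · exact key' w hw hwS hw₀
  · obtain h | rfl | ⟨w, hw, hwS, hw₀, rfl⟩ := hy.eq_or b hb
    · exact absurd h hbI
    · exact (key' v hv hvS hv₀).symm
    · have hvw : v ≠ w := fun e => hab (by rw [e])
      rcases hy.arrow v hv hvS w hw hwS hvw with ⟨z, hz, hd⟩ | ⟨z, hz, hd⟩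
      · exact key v w hv hvS hv₀ hw hwS hw₀ hab z hz hd
      · exact (key w v hw hwS hw₀ hv hvS hv₀ hab.symm z hz hd).symm

/-- Otherwise `S \ I` is a clique, so an edge `s b` missing `y v` has `s ∈ I` and `b ∉ I ∪ S`. Then
`b` is adjacent to all of `I \ S`, which therefore lies on one side. For `x` on the other side, an
edge `x z` missing `v` has `z = y v` and fails at `b`; an edge `v z` missing `x` needs `z` adjacent
to all of `I \ S`, but `s₀` misses `u₀` and each `y w` misses `w`. -/
theorem adj_extra (hy : G.IsSpokeSystem S I u₀ s₀ y) (h : G.IsCriticalSeparation S c) :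
    G.Adj s₀ u₀ := by
  by_contra hs₀
  obtain ⟨v, hv, hvS, hv₀⟩ := hy.exists_ne
  have hyS := hy.spoke_mem v hv hvS hv₀
  have hyI : y v ∉ I := fun hmem =>
    hy.not_adj _ hmem u₀ hy.mem (hy.spoke_adj v hv hvS hv₀ u₀ hy.mem hv₀.symm)
  obtain ⟨s, hs, b, hsb, hsy, hby, hsy', hby', hdom⟩ := h.exists_mem_dominatesExcept (y v)
  have hsI : s ∈ I := by
    by_contra hsI
    exact hsy' (hy.adj_of_mem hs₀ hs hsI hyS hyI hsy)
  have hbI : b ∉ I := fun hbI => hy.not_adj s hsI b hbI hsb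
  have hbS : b ∉ S := fun hbS => hby' (hy.adj_of_mem hs₀ hbS hbI hyS hyI hby)
  have hb : ∀ w ∈ I, w ∉ S → G.Adj b w := by
    intro w hw hwS
    rcases hdom w (by rintro rfl; exact hwS hyS) with rfl | rfl | h1 | h1
    · exact absurd hs hwS
    · exact absurd hw hbI
    · exact absurd h1 (hy.not_adj s hsI w hw)
    · exact h1
  have hside : ∀ w ∈ I, w ∉ S → c b = c w := fun w hw hwS => h.side_eq b w hbS hwS (hb w hw hwS)
  obtain ⟨x, hx, hxc, -⟩ := h.exists_side_ne (!c b) b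
  have hcx : c x ≠ c b := by rw [hxc]; simp
  have hxw : ∀ w ∈ I, w ∉ S → ¬ G.Adj x w := fun w hw hwS =>
    h.not_adj_of_side_ne hx hwS (by rw [← hside w hw hwS]; exact hcx)
  have hxne : ∀ w ∈ I, w ∉ S → w ≠ x := by
    rintro w hw hwS rfl
    exact hcx (hside w hw hwS).symm
  rcases h.exists_dominatesExcept_or hx hvS (hxne v hv hvS).symm (hxw v hv hvS) (w := u₀)
    (hxne _ hy.mem hy.notMem) hv₀.symm (hxw _ hy.mem hy.notMem) (hy.not_adj v hv u₀ hy.mem) with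
    ⟨z, hz, hxz, -, -, -, hzv, hdom'⟩ | ⟨z, hz, hvz, -, -, -, hzx, hdom'⟩
  · have hzu : G.Adj z u₀ := by
      rcases hdom' u₀ hv₀.symm with h1 | rfl | h1 | h1
      · exact absurd h1 (hxne _ hy.mem hy.notMem)
      · exact absurd hz hy.notMem
      · exact absurd h1 (hxw _ hy.mem hy.notMem)
      · exact h1
    have hzI : z ∉ I := fun hzI => hy.not_adj z hzI u₀ hy.mem hzu
    have hzy := hy.eq_spoke hz hzI (by rintro rfl; exact hs₀ hzu) hv hzv
    subst hzy
    rcases hdom' b (hb v hv hvS).ne with rfl | rfl | h1 | h1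
    · exact hcx rfl
    · exact hbS hyS
    · exact h.not_adj_of_side_ne hx hbS hcx h1
    · exact hby' h1.symm
  · have hzw : ∀ w ∈ I, w ∉ S → G.Adj z w := by
      intro w hw hwS
      by_cases hwv : w = v
      · rw [hwv]; exact hvz.symm
      rcases hdom' w (hxne w hw hwS) with h1 | rfl | h1 | h1
      · exact absurd h1 hwv
      · exact absurd hz hwS
      · exact absurd h1 (hy.not_adj v hv w hw)
      · exact h1
    have hzI : z ∉ I := fun hzI => hy.not_adj z hzI v hv hvz.symm
    obtain h1 | rfl | ⟨w, hw, hwS, hw₀, rfl⟩ := hy.eq_or z hz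
    · exact hzI h1
    · exact hs₀ (hzw _ hy.mem hy.notMem)
    · exact hy.spoke_not_adj w hw hwS hw₀ (hzw w hw hwS)

/-- Otherwise take a neighbour `x` of `s₀` on the side free of `I \ S`. An edge `x z` missing `u₀`
would force `z = s₀`, which is adjacent to `u₀`; an edge `u₀ z` missing `x` would have `z = y w`,
and `w` stays undominated. -/
theorem exists_side_ne (hy : G.IsSpokeSystem S I u₀ s₀ y) (h : G.IsCriticalSeparation S c) :
    ∃ v ∈ I, v ∉ S ∧ c v ≠ c u₀ := by
  by_contra! hside
  have hs₀ := hy.adj_extra h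
  obtain ⟨v, hv, hvS, hv₀⟩ := hy.exists_ne
  obtain ⟨x, hx, hxc, hs₀x⟩ := h.exists_side_adj (!c u₀) s₀ hy.mem_extra
  have hcx : c x ≠ c u₀ := by rw [hxc]; simp
  have hxw : ∀ w ∈ I, w ∉ S → ¬ G.Adj x w := fun w hw hwS =>
    h.not_adj_of_side_ne hx hwS (by rw [hside w hw hwS]; exact hcx)
  have hxne : ∀ w ∈ I, w ∉ S → w ≠ x := by
    rintro w hw hwS rfl
    exact hcx (hside w hw hwS)
  rcases h.exists_dominatesExcept_or hx hy.notMem (hxne _ hy.mem hy.notMem).symm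
    (hxw _ hy.mem hy.notMem) (w := v) (hxne v hv hvS) hv₀ (hxw v hv hvS)
    (hy.not_adj u₀ hy.mem v hv) with
    ⟨z, hz, hxz, -, -, -, hzu, hdom⟩ | ⟨z, hz, huz, -, -, -, hzx, hdom⟩
  · have hzI : z ∉ I := by
      intro hzI
      rcases hdom v hv₀ with h1 | rfl | h1 | h1
      · exact hxne v hv hvS h1
      · exact hvS hz
      · exact hxw v hv hvS h1
      · exact hy.not_adj z hzI v hv h1
    exact hzu (hy.eq_extra hz hzI hzu ▸ hs₀)
  · have hzI : z ∉ I := fun hzI => hy.not_adj z hzI u₀ hy.mem huz.symm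
    obtain h1 | rfl | ⟨w, hw, hwS, hw₀, rfl⟩ := hy.eq_or z hz
    · exact hzI h1
    · exact hzx hs₀x
    · rcases hdom w (hxne w hw hwS) with h1 | h1 | h1 | h1
      · exact hw₀ h1
      · exact hwS (by rw [h1]; exact hz)
      · exact hy.not_adj u₀ hy.mem w hw h1
      · exact hy.spoke_not_adj w hw hwS hw₀ h1

/-- All of `S \ I` is adjacent to `u₀`. This leaves a single vertex `b` outside `I ∪ S` on the side
opposite to `u₀`, so a vertex of `I \ S` on that side has too few neighbours. -/
theorem false_of_card_lt_degree [Fintype V] [DecidableEq V] [DecidableRel G.Adj]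
    (hy : G.IsSpokeSystem S I u₀ s₀ y) (h : G.IsCriticalSeparation S c)
    (hdeg : ∀ v, S.card < G.degree v) : False := by
  have hs₀ := hy.adj_extra h
  -- The alternative in `spoke_or` fails: an edge from `I` missing `u₀` would end in `s₀`, a
  -- neighbour of `u₀`.
  have hE : ∀ v ∈ I, v ∉ S → v ≠ u₀ → G.DominatesExcept u₀ (y v) v := by
    intro v hv hvS hv₀
    refine (hy.spoke_or v hv hvS hv₀).resolve_right ?_
    rintro ⟨u, hu, z, hz, hd⟩
    obtain ⟨h1, h2, h3⟩ := hd.adj_of_not_adj hy.not_adj hu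
    exact h2 (hy.eq_extra hz h1 h2 ▸ hs₀)
  have hu₀S : ∀ z ∈ S, z ∉ I → G.Adj z u₀ := by
    intro z hz hzI
    by_contra hzu
    exact hzu (hy.eq_extra hz hzI hzu ▸ hs₀)
  -- the spokes dominate the side opposite to `u₀`
  have hopp : ∀ v ∈ I, v ∉ S → v ≠ u₀ → ∀ x, x ∉ S → c x ≠ c u₀ → x ≠ v → G.Adj (y v) x := by
    intro v hv hvS hv₀ x hx hcx hxv
    obtain ⟨-, -, -, -, -, hdom⟩ := hE v hv hvS hv₀
    rcases hdom x hxv with rfl | rfl | h1 | h1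
    · exact absurd rfl hcx
    · exact absurd (hy.spoke_mem v hv hvS hv₀) hx
    · exact absurd h1 (h.not_adj_of_side_ne hy.notMem hx hcx.symm)
    · exact h1
  obtain ⟨j, hj, b, hjb, hju, hbu, hju', hbu', hdomj⟩ := h.exists_mem_dominatesExcept u₀
  have hjI : j ∈ I := by
    by_contra hjI
    exact hju' (hu₀S j hj hjI)
  have hbI : b ∉ I := fun hbI => hy.not_adj j hjI b hbI hjb
  have hbS : b ∉ S := fun hbS => hbu' (hu₀S b hbS hbI)
  have hb : ∀ w ∈ I, w ≠ u₀ → G.Adj b w := by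
    intro w hw hw₀
    rcases hdomj w hw₀ with rfl | rfl | h1 | h1
    · exact hjb.symm
    · exact absurd hw hbI
    · exact absurd h1 (hy.not_adj j hjI w hw)
    · exact h1
  obtain ⟨v, hv, hvS, hvc⟩ := hy.exists_side_ne h
  have hv₀ : v ≠ u₀ := by rintro rfl; exact hvc rfl
  have hbc : c b ≠ c u₀ := by rw [h.side_eq b v hbS hvS (hb v hv hv₀)]; exact hvc
  -- a vertex opposite to `u₀` adjacent to `I \ {u₀}` is missed by an edge at `s₀`
  have hmiss : ∀ x, x ∉ S → c x ≠ c u₀ → (∀ w ∈ I, w ≠ u₀ → G.Adj x w) →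
      ∃ d, G.DominatesExcept s₀ d x := by
    intro x hx hcx hxI
    obtain ⟨s, hs, d, hd⟩ := h.exists_mem_dominatesExcept x
    have hsx : ¬ G.Adj s x := hd.2.2.2.1
    obtain h1 | rfl | ⟨w, hw, hwS, hw₀, rfl⟩ := hy.eq_or s hs
    · exact absurd (hxI s h1 (by rintro rfl; exact hy.notMem hs)).symm hsx
    · exact ⟨d, hd⟩
    · exact absurd (hopp w hw hwS hw₀ x hx hcx
        (by rintro rfl; exact G.irrefl (hxI _ hw hw₀))) hsx
  obtain ⟨d, hs₀d, -, hdb, hs₀b, hdb', hdomd⟩ := hmiss b hbS hbc hb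
  -- Apply the edge condition to `u₀`, `x`. If the pair dominates, `x` covers `I \ {u₀}`. An edge
  -- `u₀ z` missing `x` is impossible: `s₀` does not reach `b`, and every spoke reaches `x`. In an
  -- edge `x z` missing `u₀`, the end `z` lies in `I`, so again `x` covers `I \ {u₀}`.
  have hall : ∀ x, x ∉ S → x ∉ I → c x ≠ c u₀ → ∀ w ∈ I, w ≠ u₀ → G.Adj x w := by
    intro x hx hxI hcx
    by_cases hxb : x = b
    · rw [hxb]; exact hb
    have hux : ¬ G.Adj u₀ x := h.not_adj_of_side_ne hy.notMem hx hcx.symm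
    rcases h.dominates_or u₀ x (by rintro rfl; exact hcx rfl) hux with hd |
      ⟨z, hd⟩ | ⟨z, hd⟩
    · intro w hw hw₀
      rcases hd w with h1 | rfl | h1 | h1
      · exact absurd h1 hw₀
      · exact absurd hw hxI
      · exact absurd h1 (hy.not_adj u₀ hy.mem w hw)
      · exact h1
    · exfalso
      have hz := (h.mem_or_mem hd).resolve_left hy.notMem
      obtain ⟨huz, -, -, -, hzx, hdom⟩ := hd
      obtain h1 | rfl | ⟨w, hw, hwS, hw₀, rfl⟩ := hy.eq_or z hz
      · exact hy.not_adj u₀ hy.mem z h1 huz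
      · rcases hdom b (Ne.symm hxb) with rfl | rfl | h1 | h1
        · exact hbc rfl
        · exact hbS hz
        · exact h.not_adj_of_side_ne hy.notMem hbS hbc.symm h1
        · exact hs₀b h1
      · exact hzx (hopp w hw hwS hw₀ x hx hcx (by rintro rfl; exact hxI hw))
    · have hz := (h.mem_or_mem hd).resolve_left hx
      obtain ⟨hxz, -, -, -, hzu, hdom⟩ := hd
      have hzI : z ∈ I := by
        by_contra hzI
        exact hzu (hu₀S z hz hzI)
      intro w hw hw₀
      rcases hdom w hw₀ with rfl | rfl | h1 | h1
      · exact absurd hw hxI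
      · exact hxz
      · exact h1
      · exact absurd h1 (hy.not_adj z hzI w hw)
  have hs₀x : ∀ x, x ∉ S → x ∉ I → c x ≠ c u₀ → ¬ G.Adj s₀ x := by
    intro x hx hxI hcx
    obtain ⟨_, -, -, -, hd, -⟩ := hmiss x hx hcx (hall x hx hxI hcx)
    exact hd
  have hdI : d ∈ I → d = u₀ := by
    intro hdI
    by_contra hd₀
    exact hdb' (hb d hdI hd₀).symm
  have hdS : d ∉ S := by
    intro hdS
    obtain h1 | rfl | ⟨w, hw, hwS, hw₀, rfl⟩ := hy.eq_or d hdS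
    · exact hy.notMem (hdI h1 ▸ hdS)
    · exact G.irrefl hs₀d
    · exact hdb' (hopp w hw hwS hw₀ b hbS hbc (by rintro rfl; exact hbI hw))
  have hdc : c d = c u₀ := by
    by_contra hdc
    exact hs₀x d hdS (fun hmem => hdc (by rw [hdI hmem])) hdc hs₀d
  -- The edge `s₀ d` misses only `b`, yet neither end has a neighbour outside `I ∪ S` on the side
  -- opposite to `u₀`.
  have honly : ∀ x, x ∉ S → x ∉ I → c x ≠ c u₀ → x = b := by
    intro x hx hxI hcx
    by_contra hxb
    rcases hdomd x hxb with rfl | rfl | h1 | h1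
    · exact hx hy.mem_extra
    · exact hcx hdc
    · exact hs₀x x hx hxI hcx h1
    · exact h.not_adj_of_side_ne hdS hx (by rw [hdc]; exact hcx.symm) h1
  have hyS := hy.spoke_mem v hv hvS hv₀
  have hsub : G.neighborFinset v ⊆ insert b (S.erase (y v)) := by
    intro z hz
    rw [mem_neighborFinset] at hz
    rw [Finset.mem_insert, Finset.mem_erase]
    by_cases hzS : z ∈ S
    · exact Or.inr ⟨by rintro rfl; exact hy.spoke_not_adj v hv hvS hv₀ hz.symm, hzS⟩
    · exact Or.inl (honly z hzS (fun hzI => hy.not_adj v hv z hzI hz)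
        (by rw [← h.side_eq v z hvS hzS hz]; exact hvc))
  have h1 := (Finset.card_le_card hsub).trans (Finset.card_insert_le _ _)
  rw [card_neighborFinset_eq_degree, Finset.card_erase_of_mem hyS] at h1
  have h2 := hdeg v
  have h3 := Finset.card_pos.2 ⟨_, hyS⟩
  omega

end IsSpokeSystem

/-! ### Independent sets are smaller than the cut -/

theorem IsCriticalSeparation.exists_isSpokeSystem [DecidableEq V] {S I : Finset V} {c : V → Bool}
    (h : G.IsCriticalSeparation S c) (hI : ∀ x ∈ I, ∀ y ∈ I, ¬ G.Adj x y) (hcard : I.card = S.card)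
    (hS : 3 ≤ S.card) (h2 : 2 ≤ (I \ S).card) :
    ∃ u₀ s₀ y, G.IsSpokeSystem S I u₀ s₀ y := by
  have harrow : ∀ u ∈ I, u ∉ S → ∀ v ∈ I, v ∉ S → u ≠ v →
      (∃ z ∈ S, G.DominatesExcept u z v) ∨ ∃ z ∈ S, G.DominatesExcept v z u := by
    intro u hu huS v hv hvS huv
    -- A third vertex of `I` is dominated by neither `u` nor `v`, which rules out that the pair
    -- dominates.
    obtain ⟨w, hw⟩ : ((I.erase u).erase v).Nonempty := by
      rw [← Finset.card_pos, Finset.card_erase_of_mem (by simp [hv, huv.symm]),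
        Finset.card_erase_of_mem hu]
      omega
    simp only [Finset.mem_erase] at hw
    exact h.exists_dominatesExcept_or huS hvS huv (hI u hu v hv) hw.2.1 hw.1
      (hI u hu w hw.2.2) (hI v hv w hw.2.2)
  -- Take for `u₀` a vertex of `I \ S` missed by no edge from `I` to `S`, so that the edges joining
  -- it to the others all start at `u₀`. If there is none, every vertex of `I \ S` is missed and any
  -- choice works.
  obtain ⟨u₀, hu₀, hchoice⟩ : ∃ u₀ ∈ I \ S, ∀ v ∈ I, v ∉ S → v ≠ u₀ → ∃ z ∈ S,
      (∃ u ∈ I, G.DominatesExcept u z v) ∧ (G.DominatesExcept u₀ z v ∨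
        ∃ u ∈ I, ∃ z ∈ S, G.DominatesExcept u z u₀) := by
    by_cases hsrc : ∃ u₀ ∈ I \ S, ∀ u ∈ I, ∀ z ∈ S, ¬ G.DominatesExcept u z u₀
    · obtain ⟨u₀, hu₀, hno⟩ := hsrc
      obtain ⟨hu₀I, hu₀S⟩ := Finset.mem_sdiff.1 hu₀
      refine ⟨u₀, hu₀, fun v hv hvS hv₀ => ?_⟩
      rcases harrow u₀ hu₀I hu₀S v hv hvS hv₀.symm with ⟨z, hz, hd⟩ | ⟨z, hz, hd⟩
      · exact ⟨z, hz, ⟨u₀, hu₀I, hd⟩, Or.inl hd⟩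
      · exact absurd hd (hno v hv z hz)
    · push Not at hsrc
      obtain ⟨u₀, hu₀⟩ : (I \ S).Nonempty := Finset.card_pos.1 (by omega)
      refine ⟨u₀, hu₀, fun v hv hvS hv₀ => ?_⟩
      obtain ⟨u, hu, z, hz, hd⟩ := hsrc v (Finset.mem_sdiff.2 ⟨hv, hvS⟩)
      exact ⟨z, hz, ⟨u, hu, hd⟩, Or.inr (hsrc u₀ hu₀)⟩
  have : Nonempty V := ⟨u₀⟩
  choose! y hyS hyd hyor using hchoice
  have hspoke : ∀ v ∈ I, v ∉ S → v ≠ u₀ →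
      y v ∉ I ∧ ¬ G.Adj (y v) v ∧ ∀ w ∈ I, w ≠ v → G.Adj (y v) w := by
    intro v hv hvS hv₀
    obtain ⟨u, hu, hd⟩ := hyd v hv hvS hv₀
    exact hd.adj_of_not_adj hI hu
  have hmem : ∀ v, v ∈ (I \ S).erase u₀ → v ∈ I ∧ v ∉ S ∧ v ≠ u₀ := by
    intro v hv
    simp only [Finset.mem_erase, Finset.mem_sdiff] at hv
    exact ⟨hv.2.1, hv.2.2, hv.1⟩
  have hinj : Set.InjOn y ((I \ S).erase u₀ : Finset V) := by
    intro v hv w hw hvw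
    obtain ⟨hv, hvS, hv₀⟩ := hmem v hv
    obtain ⟨hw, hwS, hw₀⟩ := hmem w hw
    by_contra hne
    exact (hspoke v hv hvS hv₀).2.1 (hvw ▸ (hspoke w hw hwS hw₀).2.2 v hv hne)
  have hsub : ((I \ S).erase u₀).image y ⊆ S \ I := by
    intro z hz
    obtain ⟨v, hv, rfl⟩ := Finset.mem_image.1 hz
    obtain ⟨hv, hvS, hv₀⟩ := hmem v hv
    exact Finset.mem_sdiff.2 ⟨hyS v hv hvS hv₀, (hspoke v hv hvS hv₀).1⟩
  -- `|I \ S| = |S \ I|`, and the spokes are distinct with one for each vertex of `I \ S` but `u₀`.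
  have hone : ((S \ I) \ ((I \ S).erase u₀).image y).card = 1 := by
    have h3 := Finset.card_sdiff_add_card_inter I S
    have h4 := Finset.card_sdiff_add_card_inter S I
    rw [Finset.inter_comm S I] at h4
    rw [Finset.card_sdiff_of_subset hsub, Finset.card_image_of_injOn hinj,
      Finset.card_erase_of_mem hu₀]
    omega
  obtain ⟨s₀, hs₀⟩ := Finset.card_eq_one.1 hone
  have hs₀mem : s₀ ∈ (S \ I) \ ((I \ S).erase u₀).image y := by
    rw [hs₀]; exact Finset.mem_singleton_self s₀
  obtain ⟨hs₀1, hs₀2⟩ := Finset.mem_sdiff.1 hs₀mem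
  obtain ⟨hs₀S, hs₀I⟩ := Finset.mem_sdiff.1 hs₀1
  obtain ⟨hu₀I, hu₀S⟩ := Finset.mem_sdiff.1 hu₀
  refine ⟨u₀, s₀, y, ⟨hI, hu₀I, hu₀S, ?_, harrow, hyS, fun v hv hvS hv₀ =>
    (hspoke v hv hvS hv₀).2.1, fun v hv hvS hv₀ => (hspoke v hv hvS hv₀).2.2, hyor, hs₀S, hs₀I,
    ?_, ?_⟩⟩
  · obtain ⟨v, hv⟩ : ((I \ S).erase u₀).Nonempty := by
      rw [← Finset.card_pos, Finset.card_erase_of_mem hu₀]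
      omega
    exact ⟨v, hmem v hv⟩
  · rintro v hv hvS hv₀ rfl
    exact hs₀2 (Finset.mem_image_of_mem y (by simp [hv, hvS, hv₀]))
  · intro s hs
    by_cases hsI : s ∈ I
    · exact Or.inl hsI
    by_cases hsY : s ∈ ((I \ S).erase u₀).image y
    · obtain ⟨v, hv, rfl⟩ := Finset.mem_image.1 hsY
      obtain ⟨hv, hvS, hv₀⟩ := hmem v hv
      exact Or.inr (Or.inr ⟨v, hv, hvS, hv₀, rfl⟩)
    · refine Or.inr (Or.inl (Finset.mem_singleton.1 ?_))
      rw [← hs₀]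
      simp only [Finset.mem_sdiff]
      exact ⟨⟨hs, hsI⟩, hsY⟩

theorem IsCriticalSeparation.indepSet_card_lt [Fintype V] [DecidableEq V] [DecidableRel G.Adj]
    [Nonempty V] {S : Finset V} {c : V → Bool} (h : G.IsCriticalSeparation S c)
    (hdeg : ∀ v, S.card < G.degree v) (I : Finset V) (hI : G.IsIndepSet I) : I.card < S.card := by
  by_contra! hle
  obtain ⟨I', hsub, hcard⟩ := Finset.exists_subset_card_eq hle
  have hI' : ∀ x ∈ I', ∀ y ∈ I', ¬ G.Adj x y := fun x hx y hy hadj =>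
    hI (hsub hx) (hsub hy) hadj.ne hadj
  have h3 := Finset.card_sdiff_add_card_inter I' S
  have h4 := Finset.card_sdiff_add_card_inter S I'
  rw [Finset.inter_comm S I'] at h4
  rcases Nat.lt_or_ge (I' \ S).card 2 with hlt | hge
  · interval_cases hm : (I' \ S).card
    · have hIS : I' = S := Finset.eq_of_subset_of_card_le
        (Finset.sdiff_eq_empty_iff_subset.1 (Finset.card_eq_zero.1 hm)) hcard.ge
      exact h.false_of_forall_not_adj (hIS ▸ hI')
    · obtain ⟨u, hu⟩ := Finset.card_eq_one.1 hm
      obtain ⟨s₀, hs₀⟩ := Finset.card_eq_one.1 (show (S \ I').card = 1 by omega)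
      exact h.false_of_sdiff_eq_singleton hI' hu hs₀
  · obtain ⟨u₀, s₀, y, hy⟩ := h.exists_isSpokeSystem hI' hcard h.three_le_card hge
    exact hy.false_of_card_lt_degree h hdeg

/-! ### Lengthening paths -/

/-- `l` is the vertex sequence of a path of `G` from `u` to `v`. -/
structure IsPathList (G : SimpleGraph V) (u v : V) (l : List V) : Prop where
  isChain : l.IsChain G.Adj
  nodup : l.Nodup
  head : l.head? = some u
  last : l.getLast? = some v

theorem IsPathList.exists_isHamiltonian [DecidableEq V] {u v : V} {l : List V}
    (h : G.IsPathList u v l) (hall : ∀ x, x ∈ l) : ∃ p : G.Walk u v, p.IsHamiltonian := by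
  have hne : l ≠ [] := by
    rintro rfl
    simpa using hall u
  have hu : l.head hne = u := by
    have := h.head; rw [List.head?_eq_some_head hne] at this; simpa using this
  have hv : l.getLast hne = v := by
    have := h.last; rw [List.getLast?_eq_some_getLast hne] at this; simpa using this
  subst hu hv
  refine ⟨Walk.ofSupport l hne h.isChain, fun x => ?_⟩
  rw [Walk.support_ofSupport]
  exact List.count_eq_one_of_mem h.nodup (hall x)

theorem Walk.IsPath.isPathList {u v : V} {p : G.Walk u v} (hp : p.IsPath) :
    G.IsPathList u v p.support where
  isChain := p.isChain_adj_support
  nodup := hp.support_nodup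
  head := by rw [List.head?_eq_some_head p.support_ne_nil, p.head_support]
  last := by rw [List.getLast?_eq_some_getLast p.support_ne_nil, p.getLast_support]

/-- A detour `d`, disjoint from the path, between consecutive vertices of the path lengthens it. -/
theorem IsPathList.insert {u v p q a b : V} {l₁ l₂ d : List V}
    (h : G.IsPathList u v (l₁ ++ p :: q :: l₂)) (hd : G.IsPathList a b d)
    (hdisj : ∀ x ∈ d, x ∉ l₁ ++ p :: q :: l₂) (hpa : G.Adj p a) (hqb : G.Adj q b) :
    G.IsPathList u v (l₁ ++ p :: (d ++ q :: l₂)) := by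
  obtain ⟨h1, h2, h3, h4⟩ := h
  obtain ⟨d1, d2, d3, d4⟩ := hd
  have hperm : (l₁ ++ p :: (d ++ q :: l₂)).Perm (d ++ (l₁ ++ p :: q :: l₂)) := by
    classical
    rw [List.perm_iff_count]
    intro x
    simp only [List.count_append, List.count_cons]
    omega
  refine ⟨?_, ?_, ?_, ?_⟩
  · rw [List.isChain_append] at h1 ⊢
    rw [List.isChain_cons_cons] at h1
    refine ⟨h1.1, ?_, by simpa using h1.2.2⟩
    rw [List.isChain_cons, List.isChain_append]
    refine ⟨?_, d1, h1.2.1.2, ?_⟩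
    · simp only [List.head?_append, d3]
      simpa using hpa
    · simp only [d4, List.head?_cons]
      simpa using hqb.symm
  · rw [hperm.nodup_iff, List.nodup_append']
    exact ⟨d2, h2, fun x hx hx' => hdisj x hx hx'⟩
  · rw [← h3]; simp [List.head?_append]
  · rw [← h4]; simp [List.getLast?_append, List.getLast?_cons]

/-- Rerouting a path along a detour `d` and a chord joining two successors lengthens it. -/
theorem IsPathList.reroute {u v p p' q q' a b : V} {l₁ m l₂ d : List V}
    (h : G.IsPathList u v (l₁ ++ p :: (m ++ q' :: l₂))) (hm : G.IsPathList p' q m)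
    (hd : G.IsPathList a b d) (hdisj : ∀ x ∈ d, x ∉ l₁ ++ p :: (m ++ q' :: l₂))
    (hpa : G.Adj p a) (hqb : G.Adj q b) (hpq : G.Adj p' q') :
    G.IsPathList u v (l₁ ++ p :: (d ++ (m.reverse ++ q' :: l₂))) := by
  -- The new path goes from `u` to `p`, along `d` to `q`, backwards along `m` to `p'`, then by the
  -- chord to `q'` and on to `v`.
  obtain ⟨h1, h2, h3, h4⟩ := h
  obtain ⟨m1, m2, m3, m4⟩ := hm
  obtain ⟨d1, d2, d3, d4⟩ := hd
  have hperm : (l₁ ++ p :: (d ++ (m.reverse ++ q' :: l₂))).Perm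
      (d ++ (l₁ ++ p :: (m ++ q' :: l₂))) := by
    classical
    rw [List.perm_iff_count]
    intro x
    simp only [List.count_append, List.count_cons, List.count_reverse]
    omega
  refine ⟨?_, ?_, ?_, ?_⟩
  · rw [List.isChain_append, List.isChain_cons, List.isChain_append] at h1
    rw [List.isChain_append, List.isChain_cons, List.isChain_append, List.isChain_append,
      List.isChain_reverse]
    refine ⟨h1.1, ⟨?_, d1, ⟨?_, h1.2.1.2.2.1, ?_⟩, ?_⟩, by simpa using h1.2.2⟩
    · simp only [List.head?_append, d3]
      simpa using hpa
    · exact m1.imp fun _ _ h => h.symm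
    · simp only [List.getLast?_reverse, m3, List.head?_cons]
      simpa using hpq
    · simp only [List.head?_append, List.head?_reverse, m4, d4]
      simpa using hqb.symm
  · rw [hperm.nodup_iff, List.nodup_append']
    exact ⟨d2, h2, fun x hx hx' => hdisj x hx hx'⟩
  · rw [← h3]; simp [List.head?_append]
  · rw [← h4]; simp [List.getLast?_append, List.getLast?_cons]

theorem exists_isPathList_of_reachable_induce {T : Set V} {a b : T}
    (h : (G.induce T).Reachable a b) : ∃ d, G.IsPathList a b d ∧ ∀ x ∈ d, x ∈ T := by
  classical
  obtain ⟨p, hp⟩ := h.exists_isPath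
  refine ⟨(p.map (Embedding.induce T).toHom).support,
    (Walk.IsPath.map (f := (Embedding.induce T).toHom) Subtype.val_injective hp).isPathList, fun x hx => ?_⟩
  rw [Walk.support_map, List.mem_map] at hx
  obtain ⟨y, -, rfl⟩ := hx
  exact y.2

theorem exists_longest_isPathList [Fintype V] {u v : V} (h : G.Reachable u v) :
    ∃ l, G.IsPathList u v l ∧ ∀ l', G.IsPathList u v l' → l'.length ≤ l.length := by
  classical
  obtain ⟨p, hp⟩ := h.exists_isPath
  have hfin : ∀ l, G.IsPathList u v l → l.length ≤ Fintype.card V :=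
    fun l hl => hl.nodup.length_le_card
  have hspec := Nat.findGreatest_spec (P := fun n => ∃ l, G.IsPathList u v l ∧ l.length = n)
    (hfin _ hp.isPathList) ⟨_, hp.isPathList, rfl⟩
  obtain ⟨l, hl, hlen⟩ := hspec
  exact ⟨l, hl, fun l' hl' => hlen ▸ Nat.le_findGreatest (hfin l' hl') ⟨l', hl', rfl⟩⟩

theorem IsPathList.segment {u v : V} {l : List V} (h : G.IsPathList u v l) {i j : ℕ} (hij : i ≤ j)
    (hj : j < l.length) : G.IsPathList l[i] l[j] ((l.drop i).take (j - i + 1)) where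
  isChain := (h.isChain.drop i).take _
  nodup := h.nodup.sublist ((List.take_sublist _ _).trans (List.drop_sublist _ _))
  head := by
    rw [List.head?_take, if_neg (by omega), List.head?_drop, List.getElem?_eq_getElem]
  last := by
    rw [List.getLast?_take, if_neg (by omega)]
    simp only [Nat.add_sub_cancel, List.getElem?_drop]
    rw [show i + (j - i) = j by omega, List.getElem?_eq_getElem hj]
    rfl

section Longest

variable {u v : V} {l : List V}

theorem IsPathList.not_adj_detour (hl : G.IsPathList u v l)
    (hmax : ∀ l', G.IsPathList u v l' → l'.length ≤ l.length) {a b : V} {d : List V}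
    (hd : G.IsPathList a b d) (hdisj : ∀ x ∈ d, x ∉ l) {i : ℕ} (hi : i + 1 < l.length)
    (hia : G.Adj l[i] a) : ¬ G.Adj l[i + 1] b := by
  intro hib
  have hdec : l = l.take i ++ l[i] :: l[i + 1] :: l.drop (i + 2) := by
    conv_lhs => rw [← List.take_append_drop i l, List.drop_eq_getElem_cons (by omega),
      List.drop_eq_getElem_cons hi]
  have hdne : d ≠ [] := by
    rintro rfl
    simpa using hd.head
  have hlen := List.length_pos_of_ne_nil hdne
  have hnew := hmax _ (IsPathList.insert (hdec ▸ hl) hd (hdec ▸ hdisj) hia hib)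
  have hlen2 := congrArg List.length hdec
  simp only [List.length_append, List.length_cons] at hnew hlen2
  omega

theorem IsPathList.not_adj_successors (hl : G.IsPathList u v l)
    (hmax : ∀ l', G.IsPathList u v l' → l'.length ≤ l.length) {a b : V} {d : List V}
    (hd : G.IsPathList a b d) (hdisj : ∀ x ∈ d, x ∉ l) {i j : ℕ} (hij : i < j)
    (hj : j + 1 < l.length) (hia : G.Adj l[i] a) (hjb : G.Adj l[j] b) :
    ¬ G.Adj l[i + 1] l[j + 1] := by
  intro hadj
  have hdec : l = l.take i ++ l[i] ::
      ((l.drop (i + 1)).take (j - (i + 1) + 1) ++ l[j + 1] :: l.drop (j + 2)) := by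
    conv_lhs => rw [← List.take_append_drop i l, List.drop_eq_getElem_cons (by omega),
      ← List.take_append_drop (j - (i + 1) + 1) (l.drop (i + 1)), List.drop_drop,
      show i + 1 + (j - (i + 1) + 1) = j + 1 by omega, List.drop_eq_getElem_cons hj]
  have hdne : d ≠ [] := by
    rintro rfl
    simpa using hd.head
  have hlen := List.length_pos_of_ne_nil hdne
  have hnew := hmax _ (IsPathList.reroute (hdec ▸ hl)
    (hl.segment (i := i + 1) (j := j) (by omega) (by omega)) hd (hdec ▸ hdisj) hia hjb hadj)
  have hlen2 := congrArg List.length hdec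
  simp only [List.length_append, List.length_cons, List.length_reverse] at hnew hlen2
  omega

end Longest

/-! ### The Chvátal–Erdős condition -/

/-- The Chvátal–Erdős theorem for hamiltonian connected graphs: a connected graph is hamiltonian
connected if all of its independent sets are smaller than all of its vertex cuts. -/
theorem isHamiltonianConnected_of_indepSet_card_lt [Fintype V] [DecidableEq V] {k : ℕ}
    (hconn : G.Preconnected) (hk : ∀ T, G.IsVertexCut T → k ≤ T.ncard)
    (hindep : ∀ I : Finset V, G.IsIndepSet I → I.card < k) : G.IsHamiltonianConnected := by
  classical
  intro u v huv
  obtain ⟨l, hl, hmax⟩ := exists_longest_isPathList (hconn u v)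
  apply hl.exists_isHamiltonian
  by_contra! hne
  obtain ⟨h, hh⟩ := hne
  let T : Set V := {x | x ∉ l}
  let H : V → Prop := fun x => ∃ hx : x ∈ T, (G.induce T).Reachable ⟨h, hh⟩ ⟨x, hx⟩
  have hHh : H h := ⟨hh, Reachable.refl _⟩
  have hdetour : ∀ a b, H a → H b → ∃ d, G.IsPathList a b d ∧ ∀ x ∈ d, x ∉ l := by
    rintro a b ⟨ha, hra⟩ ⟨hb, hrb⟩
    exact exists_isPathList_of_reachable_induce (hra.symm.trans hrb)
  have hlen : 1 < l.length := by
    rcases l with _ | ⟨x, _ | ⟨y, l⟩⟩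
    · simpa using hl.head
    · have h1 := hl.head
      have h2 := hl.last
      simp at h1 h2
      exact absurd (h1.symm.trans h2) huv
    · simp
  -- `H` is a component of the graph off the longest path, and `N` is its set of neighbours on the
  -- path. The successors of `N` together with `h` will be an independent set that is too large.
  let N : Finset V := l.toFinset.filter fun p => ∃ a, H a ∧ G.Adj p a
  have hN : ∀ p, p ∈ N ↔ p ∈ l ∧ ∃ a, H a ∧ G.Adj p a := by simp [N]
  have hsucc : ∀ i (hi : i + 1 < l.length), l[i] ∈ N → l[i + 1] ∉ N := by
    intro i hi h1 h2
    obtain ⟨-, a, ha, hia⟩ := (hN _).1 h1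
    obtain ⟨-, b, hb, hib⟩ := (hN _).1 h2
    obtain ⟨d, hd, hdl⟩ := hdetour a b ha hb
    exact hl.not_adj_detour hmax hd hdl hi hia hib
  -- `N` separates `H` from the rest of the path, which is nonempty because `N` contains no two
  -- consecutive vertices.
  have hcut : G.IsVertexCut (N : Set V) := by
    obtain ⟨x, hxl, hxN⟩ : ∃ x ∈ l, x ∉ N := by
      by_cases h0 : l[0] ∈ N
      · exact ⟨l[1], List.getElem_mem _, hsucc 0 hlen h0⟩
      · exact ⟨l[0], List.getElem_mem _, h0⟩
    refine isVertexCut_of_closed (P := H) (a := h) (b := x) ?_ (by simpa using hxN) hHh ?_ ?_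
    · exact fun hmem => hh ((hN h).1 (by simpa using hmem)).1
    · exact fun ⟨hx, _⟩ => hx hxl
    · intro y z hy hz hyz hHy
      have hzl : z ∉ l := fun hzl => hz (by simpa using (hN z).2 ⟨hzl, y, hHy, hyz.symm⟩)
      obtain ⟨hyT, hry⟩ := hHy
      have : (G.induce T).Adj ⟨y, hyT⟩ ⟨z, hzl⟩ := hyz
      exact ⟨hzl, hry.trans this.reachable⟩
  have hkN := hk _ hcut
  rw [Set.ncard_coe_finset] at hkN
  -- The default `u` is immaterial: `f` is only evaluated at indices within the path.
  let f : ℕ → V := fun i => l.getD i u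
  have hf : ∀ i (hi : i < l.length), f i = l[i] := fun i hi => by simp [f, hi]
  -- The last vertex is excluded, having no successor. This loses at most one element of `N`, and
  -- `h` makes up for it, so `|I| ≥ |N| ≥ k`.
  let J : Finset ℕ := (Finset.range (l.length - 1)).filter fun i => f i ∈ N
  have hJ : ∀ i, i ∈ J ↔ i < l.length - 1 ∧ f i ∈ N := by simp [J]
  have hNJ : N ⊆ insert (f (l.length - 1)) (J.image f) := by
    intro x hx
    obtain ⟨i, hi, rfl⟩ := List.mem_iff_getElem.1 ((hN x).1 hx).1
    rw [← hf i hi] at hx ⊢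
    rw [Finset.mem_insert, Finset.mem_image]
    by_cases hil : i = l.length - 1
    · exact Or.inl (by rw [hil])
    · exact Or.inr ⟨i, (hJ i).2 ⟨by omega, hx⟩, rfl⟩
  have hcard1 : N.card ≤ J.card + 1 :=
    (Finset.card_le_card hNJ).trans ((Finset.card_insert_le _ _).trans
      (Nat.add_le_add_right Finset.card_image_le 1))
  let I : Finset V := insert h (J.image fun i => f (i + 1))
  have hcardI : I.card = J.card + 1 := by
    rw [Finset.card_insert_of_notMem, Finset.card_image_of_injOn]
    · intro i hi j hj hij
      have hi := ((hJ i).1 (by simpa using hi)).1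
      have hj := ((hJ j).1 (by simpa using hj)).1
      simp only at hij
      rw [hf _ (by omega), hf _ (by omega)] at hij
      have := (hl.nodup.getElem_inj_iff).1 hij
      omega
    · intro hmem
      obtain ⟨i, hi, hih⟩ := Finset.mem_image.1 hmem
      have hi := ((hJ i).1 hi).1
      rw [hf _ (by omega)] at hih
      exact hh (hih ▸ List.getElem_mem _)
  have hlt : ∀ i ∈ J, ∀ j ∈ J, i < j → ¬ G.Adj (f (i + 1)) (f (j + 1)) := by
    intro i hi j hj hij
    obtain ⟨hi, hiN⟩ := (hJ i).1 hi
    obtain ⟨hj, hjN⟩ := (hJ j).1 hj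
    rw [hf _ (by omega)] at hiN hjN
    rw [hf _ (by omega), hf _ (by omega)]
    obtain ⟨-, a, ha, hia⟩ := (hN _).1 hiN
    obtain ⟨-, b, hb, hjb⟩ := (hN _).1 hjN
    obtain ⟨d, hd, hdl⟩ := hdetour a b ha hb
    exact hl.not_adj_successors hmax hd hdl hij (by omega) hia hjb
  have hhJ : ∀ i ∈ J, ¬ G.Adj (f (i + 1)) h := by
    intro i hi hadj
    obtain ⟨hi, hiN⟩ := (hJ i).1 hi
    rw [hf _ (by omega)] at hiN hadj
    exact hsucc i (by omega) hiN ((hN _).2 ⟨List.getElem_mem _, h, hHh, hadj⟩)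
  have hI : G.IsIndepSet I := by
    intro x hx y hy hxy hadj
    simp only [I, Finset.coe_insert, Finset.coe_image, Set.mem_insert_iff, Set.mem_image,
      Finset.mem_coe] at hx hy
    rcases hx with rfl | ⟨i, hi, rfl⟩ <;> rcases hy with rfl | ⟨j, hj, rfl⟩
    · exact hxy rfl
    · exact hhJ j hj hadj.symm
    · exact hhJ i hi hadj
    · rcases lt_trichotomy i j with hij | rfl | hij
      · exact hlt i hi j hj hij hadj
      · exact hxy rfl
      · exact hlt j hj i hi hij hadj.symm
  have := hindep I hI
  omega

end

end SimpleGraph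

/-! ### The corollary -/

theorem corollary4p7 {V : Type*} [Fintype V] [DecidableEq V]
    (G : SimpleGraph V) [DecidableRel G.Adj]
    (hG : G.IsMaximalConnectedDominationVertexCritical 3)
    (hκδ : G.vertexConnectivity < G.minDegree) :
    G.IsHamiltonianConnected := by
  obtain ⟨S, c, hS, hc, hne, hadj⟩ := SimpleGraph.exists_separation hκδ
  have hdeg : ∀ v, S.card < G.degree v := fun v => by
    rw [hS]; exact hκδ.trans_le (G.minDegree_le_degree v)
  have hnbr : ∀ v, ∃ w, G.Adj v w := fun v =>
    (G.degree_pos_iff_exists_adj v).1 ((Nat.zero_le _).trans_lt (hdeg v))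
  have hsep : G.IsCriticalSeparation S c :=
    ⟨fun _ _ huv => hG.1.dominates_or_exists_dominatesExcept hnbr huv,
      hG.2.exists_dominatesExcept hnbr, hc, hne, hadj⟩
  intro u v
  have : Nonempty V := ⟨u⟩
  have hcut : ∀ T, G.IsVertexCut T → S.card ≤ T.ncard := fun T hT => by
    rw [hS]; exact hT.vertexConnectivity_le
  refine SimpleGraph.isHamiltonianConnected_of_indepSet_card_lt ?_ hcut
    (hsep.indepSet_card_lt hdeg) u v
  -- If `G` were disconnected the empty set would be a cut, while every cut has at least `|S| ≥ 3`
  -- vertices.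
  by_contra hconn
  simp only [SimpleGraph.Preconnected, not_forall] at hconn
  obtain ⟨a, b, hab⟩ := hconn
  have h0 : G.IsVertexCut ∅ := SimpleGraph.isVertexCut_of_closed (P := G.Reachable a)
    (a := a) (b := b) (by simp) (by simp) (SimpleGraph.Reachable.refl a) hab
    (fun _ _ _ _ hxy h => h.trans hxy.reachable)
  have h1 := hcut _ h0
  have h2 := hsep.three_le_card
  rw [Set.ncard_empty] at h1
  omega
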